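/- Let $\mathbb{K}=\mathbb{R}$ or $\mathbb{C}$, and for $p\in[1,\infty]$ let $\ell_p^n$ be $\mathbb{K}^n$ with the $\ell_p$ norm and canonical basis $e_1,\dots,e_n$ (with $1/\infty=0$). For an $m$-linear form $A\colon\ell_{p_1}^n\times\cdots\times\ell_{p_m}^n\to\mathbb{K}$ put $\|A\|=\sup\{|A(z^{(1)},\dots,z^{(m)})| : \|z^{(j)}\|_{\ell_{p_j}^n}\le 1\}$. We say that the Hardy--Littlewood (HL) inequality holds for $(p_1,\dots,p_m)$ with exponents $(t_1,\dots,t_m)\in(0,\infty]^m$ and constant $C$ if, for all positive integers $n$ and all $m$-linear forms $A\colon\ell_{p_1}^n\times\cdots\times\ell_{p_m}^n\to\mathbb{K}$, $$\left(\sum_{j_1=1}^n\left(\sum_{j_2=1}^n\cdots\left(\sum_{j_m=1}^n|A(e_{j_1},\dots,e_{j_m})|^{t_m}\right)^{\frac{t_{m-1}}{t_m}}\cdots\right)^{\frac{t_1}{t_2}}\right)^{\frac1{t_1}}\le C\,\|A\|,$$ where the $\ell_{t_k}$ norm in the $k$-th index is replaced by a maximum if $t_k=\infty$. Let $m\ge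 2$. There is a constant $C_m$, depending only on $m$, such that the following holds. Let $p_1,\dots,p_m\in[1,\infty]$ satisfy $\frac12\le\frac1{p_1}+\cdots+\frac1{p_m}<1$, and let $i\in\{1,\dots,m\}$ be such that $1<p_i\le 2$. Put $$s_k=\left[1-\left(\frac1{p_k}+\cdots+\frac1{p_m}\right)\right]^{-1}\ \text{ if } k\le i,\qquad s_k=2\ \text{ if } k>i.$$ 1. The HL inequality holds for $(p_1,\dots,p_m)$ with exponents $(s_1,\dots,s_m)$ and constant $C_m$. If $i=m$, it holds with constant $1$ (which recovers the theorem of Aron et al.). 2. The exponents $s_1,\dots,s_i$ are optimal: if $(t_1,\dots,t_m)\in(0,\infty]^m$ and the HL inequality holds for $(p_1,\dots,p_m)$ with exponents $(t_1,\dots,t_m)$ and some constant, then $t_k\ge s_k$ for all $k\le i$. -/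

import Mathlib

open scoped ENNReal

noncomputable section

/-- The iterated (anisotropic) sum with exponents `s 0, …, s (m-1)`, the first index outermost:
`(∑_{j₁} (⋯ (∑_{j_m} ‖f (j₁, …, j_m)‖ ^ s_m) ^ (s_{m-1} / s_m) ⋯) ^ (s₁ / s₂)) ^ (1 / s₁)`.
For `0 < r < ∞` the norm on `PiLp r` is `(∑ j, ‖x j‖ ^ r) ^ (1 / r)`; for `r = ∞` it is the
maximum. -/
def mixedNorm {𝕜 : Type*} [RCLike 𝕜] {n : ℕ} :
    {m : ℕ} → (Fin m → ℝ≥0∞) → ((Fin m → Fin n) → 𝕜) → ℝ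
  | 0, _, f => ‖f Fin.elim0‖
  | _ + 1, s, f =>
      ‖(WithLp.toLp (s 0) (fun j : Fin n =>
          mixedNorm (fun k => s k.succ) (fun J => f (Fin.cons j J))) :
        PiLp (s 0) (fun _ : Fin n => ℝ))‖

/-- The Hardy-Littlewood inequality with exponents `s` and constant `C`, for all positive integers
`n` and all `m`-linear forms `A` on `ℓ_{p₁}ⁿ × ⋯ × ℓ_{p_m}ⁿ`. All such forms are continuous, because
the spaces are finite-dimensional, and `‖A‖` is the operator norm, that is, the supremum of
`|A (z₁, …, z_m)|` over the `z_k` in the closed unit balls of `ℓ_{p_k}ⁿ`. -/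
def HardyLittlewoodInequality (𝕜 : Type*) [RCLike 𝕜] {m : ℕ} (p : Fin m → ℝ≥0∞)
    [∀ k, Fact (1 ≤ p k)] (s : Fin m → ℝ≥0∞) (C : ℝ) : Prop :=
  ∀ n : ℕ, 0 < n →
    ∀ A : ContinuousMultilinearMap 𝕜 (fun k : Fin m => PiLp (p k) (fun _ : Fin n => 𝕜)) 𝕜,
      mixedNorm s (fun J : Fin m → Fin n =>
        A (fun k => WithLp.toLp (p k) (Pi.single (J k) (1 : 𝕜)))) ≤ C * ‖A‖

/-- `s_k = [1 - (1/p_k + ⋯ + 1/p_m)]⁻¹` if `k ≤ i`, and `s_k = 2` if `k > i`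
(computed in `[0, ∞]`, so `1/∞ = 0`). -/
def hlExponent {m : ℕ} (p : Fin m → ℝ≥0∞) (i k : Fin m) : ℝ≥0∞ :=
  if k ≤ i then (1 - ∑ j ∈ Finset.Ici k, (p j)⁻¹)⁻¹ else 2

end

/-! Put r_k = 1/p_k. A vector in the unit ball of ℓ_{1/r} is a weight y^r, with y ≥ 0 and ∑ y ≤ 1,
times a vector in the unit ball of ℓ_∞. A bound valid for all such weights, optimized over y, lowers
the reciprocal of the exponent by r (`sum_rpow_le_of_forall_weighted`).

Inequality: the variables before i are peeled off one at a time. Since r_i ≥ 1/2, the exponents are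
antitone and at least 2, so the mixed norm of the remaining indices has cotype q with constant 1,
where 1/q is 1 minus the sum of the remaining r_k (`sum_mixedNorm_rpow_le_expect`). Substituting
random signs times a weight in the first variable leaves a form in the others with the same bound.
Induction and cotype give an ℓ_q estimate for the weighted slices, and optimizing the weight gives
the outermost exponent. No constant is lost.

When i has become the first variable, either it is the only one, and ℓ_p duality gives constant 1,
or iterated Khinchine gives an ℓ_1(ℓ_2) estimate with all weights frozen (`sum_sqrt_sum_sq_le`). The
r_k with k ≠ i sum to less than 1/2, so their weights can be removed while the outer exponent stays
at most 2 (`sum_rpow_le_of_forall_weighted_finset`). The weight of variable i sits on the outer sum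
and is removed last, with no such restriction.

Optimality: the diagonal form in the variables from k on, with the earlier ones frozen at one
coordinate, has n unit coefficients and norm at most n^(1 - (r_k + ⋯ + r_m)). Letting n → ∞ bounds
t_k from below. -/

open scoped BigOperators

/-! ### Hölder arguments: removing weights -/

/-- Hölder's inequality with exponents `1 / a` and `1 / b`. -/
theorem sum_rpow_mul_rpow_le {ι : Type*} (s : Finset ι) {f g : ι → ℝ} (hf : ∀ i, 0 ≤ f i)
    (hg : ∀ i, 0 ≤ g i) {a b : ℝ} (ha : 0 ≤ a) (hb : 0 ≤ b) (hab : a + b = 1) :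
    ∑ i ∈ s, f i ^ a * g i ^ b ≤ (∑ i ∈ s, f i) ^ a * (∑ i ∈ s, g i) ^ b := by
  rcases ha.eq_or_lt with rfl | ha
  · obtain rfl : b = 1 := by linarith
    simp
  rcases hb.eq_or_lt with rfl | hb
  · obtain rfl : a = 1 := by linarith
    simp
  have hc : Real.HolderConjugate a⁻¹ b⁻¹ :=
    Real.holderConjugate_iff.2 ⟨by rw [lt_inv_comm₀ one_pos ha]; simp; linarith, by simpa using hab⟩
  have h := Real.inner_le_Lp_mul_Lq_of_nonneg s hc (f := fun i => f i ^ a) (g := fun i => g i ^ b)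
    (fun i _ => Real.rpow_nonneg (hf i) _) (fun i _ => Real.rpow_nonneg (hg i) _)
  simpa [Real.rpow_rpow_inv (hf _) ha.ne', Real.rpow_rpow_inv (hg _) hb.ne'] using h

/-- Optimizing over all weights in the unit ball of `ℓ_{1/r}` improves `ℓ_u` to `ℓ_v`. -/
theorem sum_rpow_le_of_forall_weighted {α : Type*} [Fintype α] {D : α → ℝ} (hD : ∀ j, 0 ≤ D j)
    {M : ℝ} (hM : 0 ≤ M) {u v r : ℝ} (hu : 0 < u) (hv : 0 < v) (h : v⁻¹ = u⁻¹ - r)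
    (H : ∀ y : α → ℝ, (∀ j, 0 ≤ y j) → ∑ j, y j ≤ 1 → ∑ j, (y j ^ r * D j) ^ u ≤ M ^ u) :
    ∑ j, D j ^ v ≤ M ^ v := by
  set S := ∑ j, D j ^ v with hS
  have hS0 : 0 ≤ S := Finset.sum_nonneg fun j _ => Real.rpow_nonneg (hD j) _
  rcases hS0.eq_or_lt with h0 | hS0
  · rw [← h0]; positivity
  -- The extremal weight for Hölder's inequality.
  have key := H (fun j => D j ^ v / S) (fun j => div_nonneg (Real.rpow_nonneg (hD j) _) hS0.le)
    (by rw [← Finset.sum_div, div_self hS0.ne'])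
  have hr : v * r * u + u = v := by
    have : r = u⁻¹ - v⁻¹ := by linarith
    rw [this]; field_simp; ring
  have e : ∀ j, ((D j ^ v / S) ^ r * D j) ^ u = D j ^ v / S ^ (r * u) := by
    intro j
    rcases (hD j).eq_or_lt with h0 | hj
    · rw [← h0, mul_zero, Real.zero_rpow hu.ne', Real.zero_rpow hv.ne', zero_div]
    · rw [Real.mul_rpow (by positivity) hj.le, ← Real.rpow_mul (by positivity),
        Real.div_rpow (by positivity) hS0.le, ← Real.rpow_mul hj.le, div_mul_eq_mul_div,
        ← Real.rpow_add hj]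
      congr 2
      linarith
  simp only [e] at key
  rw [← Finset.sum_div, ← hS] at key
  have hru : 1 - r * u = u / v := by
    field_simp; linarith
  have e2 : S / S ^ (r * u) = S ^ (u / v) := by
    rw [← hru, Real.rpow_sub hS0, Real.rpow_one]
  rw [e2] at key
  calc S = (S ^ (u / v)) ^ (v / u) := by
        rw [← Real.rpow_mul hS0.le]; field_simp; rw [Real.rpow_one]
    _ ≤ (M ^ u) ^ (v / u) := Real.rpow_le_rpow (by positivity) key (by positivity)
    _ = M ^ v := by rw [← Real.rpow_mul hM]; congr 1; field_simp

/-- Removing the weights from the inner sum of a nonnegative matrix, given the bound in which the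
order of the two sums is exchanged. -/
theorem sum_rpow_le_of_forall_weighted_inner {α β : Type*} [Fintype α] [Fintype β]
    {c : α → β → ℝ} (hc : ∀ j l, 0 ≤ c j l) {M : ℝ} (hM : 0 ≤ M) {u v r : ℝ} (hu : 0 < u)
    (huv : u ≤ v) (hv2 : v ≤ 2) (h : v⁻¹ = u⁻¹ - r)
    (H : ∀ y : β → ℝ, (∀ l, 0 ≤ y l) → ∑ l, y l ≤ 1 →
      ∑ j, (∑ l, c j l * y l ^ (2 * r)) ^ (u / 2) ≤ M ^ u)
    (H' : ∑ l, (∑ j, c j l) ^ (v / 2) ≤ M ^ v) :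
    ∑ j, (∑ l, c j l) ^ (v / 2) ≤ M ^ v := by
  -- At v = 2 both sides of the exchange are the full double sum.
  rcases hv2.eq_or_lt with rfl | hv2
  · norm_num at H' ⊢
    rwa [Finset.sum_comm]
  have hv : 0 < v := hu.trans_le huv
  have hu2 : u < 2 := huv.trans_lt hv2
  set S : α → ℝ := fun j => ∑ l, c j l with hSdef
  have hS : ∀ j, 0 ≤ S j := fun j => Finset.sum_nonneg fun l _ => hc j l
  have hcS : ∀ j l, S j = 0 → c j l = 0 := fun j l h0 =>
    (Finset.sum_eq_zero_iff_of_nonneg fun l _ => hc j l).1 h0 l (Finset.mem_univ l)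
  -- Linearization: ∑ l, c j l * S j ^ (u / 2 - 1) = S j ^ (u / 2), so the weight on l can be
  -- optimized in a sum over l. The power is negative, but where `S j = 0` the whole row of `c`
  -- vanishes.
  set E : β → ℝ := fun l => ∑ j, c j l * S j ^ (u / 2 - 1) with hEdef
  have hE : ∀ l, 0 ≤ E l := fun l =>
    Finset.sum_nonneg fun j _ => mul_nonneg (hc j l) (Real.rpow_nonneg (hS j) _)
  set d : β → ℝ := fun l => ∑ j, c j l with hddef
  have hd : ∀ l, 0 ≤ d l := fun l => Finset.sum_nonneg fun j _ => hc j l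
  have h1 : ∑ l, E l ^ (v / u) ≤ M ^ v := by
    have := sum_rpow_le_of_forall_weighted (D := fun l => E l ^ u⁻¹)
      (fun l => Real.rpow_nonneg (hE l) _) hM hu hv h ?_
    · refine le_of_eq_of_le (Finset.sum_congr rfl fun l _ => ?_) this
      rw [← Real.rpow_mul (hE l)]; congr 1; field_simp
    · intro y hy hy1
      refine le_trans ?_ (H y hy hy1)
      have e : ∀ l, (y l ^ r * E l ^ u⁻¹) ^ u = ∑ j, y l ^ (r * u) * (c j l * S j ^ (u / 2 - 1)) := by
        intro l
        rw [Real.mul_rpow (Real.rpow_nonneg (hy l) _) (Real.rpow_nonneg (hE l) _),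
          Real.rpow_inv_rpow (hE l) hu.ne', ← Real.rpow_mul (hy l), ← Finset.mul_sum]
      simp only [e]
      rw [Finset.sum_comm]
      refine Finset.sum_le_sum fun j _ => ?_
      rcases (hS j).eq_or_lt with h0 | hj
      · have : ∀ l, c j l = 0 := fun l => hcS j l h0.symm
        simp only [this]
        simp [Real.zero_rpow (by positivity : u / 2 ≠ 0)]
      have hol := sum_rpow_mul_rpow_le Finset.univ
        (f := fun l => c j l * y l ^ (2 * r)) (g := c j)
        (fun l => mul_nonneg (hc j l) (Real.rpow_nonneg (hy l) _)) (hc j)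
        (a := u / 2) (b := 1 - u / 2) (by positivity) (by linarith) (by ring)
      have e3 : ∀ l, (c j l * y l ^ (2 * r)) ^ (u / 2) * c j l ^ (1 - u / 2)
          = y l ^ (r * u) * c j l := by
        intro l
        rw [Real.mul_rpow (hc j l) (Real.rpow_nonneg (hy l) _), ← Real.rpow_mul (hy l),
          mul_right_comm, ← Real.rpow_add_of_nonneg (hc j l) (by positivity) (by linarith),
          mul_comm]
        congr 2
        · ring
        · rw [show u / 2 + (1 - u / 2) = 1 by ring, Real.rpow_one]
      simp only [e3] at hol
      calc ∑ l, y l ^ (r * u) * (c j l * S j ^ (u / 2 - 1))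
          = (∑ l, y l ^ (r * u) * c j l) * S j ^ (u / 2 - 1) := by
            rw [Finset.sum_mul]; exact Finset.sum_congr rfl fun l _ => by ring
        _ ≤ ((∑ l, c j l * y l ^ (2 * r)) ^ (u / 2) * S j ^ (1 - u / 2)) * S j ^ (u / 2 - 1) := by
            gcongr
        _ = _ := by
            rw [mul_assoc, ← Real.rpow_add hj]; simp
  -- Interpolation: θ is chosen so that θ(u/2 - 1) = v/2 - 1. Hölder in j, then in l, separates the
  -- bound on `E` from the exchanged bound `H'` on `d`.
  set θ := (2 - v) / (2 - u) with hθ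
  have hθ0 : 0 ≤ θ := div_nonneg (by linarith) (by linarith)
  have hθ1 : 0 ≤ 1 - θ := by
    rw [sub_nonneg, hθ, div_le_one (by linarith)]; linarith
  have hθe : θ * (2 - u) = 2 - v := div_mul_cancel₀ _ (by linarith)
  have hsum : θ * u / v + (1 - θ) * 2 / v = 1 := by
    field_simp; linarith
  calc ∑ j, S j ^ (v / 2) = ∑ j, ∑ l, c j l * S j ^ (v / 2 - 1) := by
        refine Finset.sum_congr rfl fun j _ => ?_
        rw [← Finset.sum_mul]
        rcases (hS j).eq_or_lt with h0 | hj
        · change _ = S j * _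
          rw [← h0, zero_mul, Real.zero_rpow (by positivity)]
        · change _ = S j * _
          nth_rewrite 2 [← Real.rpow_one (S j)]
          rw [← Real.rpow_add hj]; congr 1; ring
    _ = ∑ l, ∑ j, (c j l * S j ^ (u / 2 - 1)) ^ θ * c j l ^ (1 - θ) := by
        rw [Finset.sum_comm]
        refine Finset.sum_congr rfl fun l _ => Finset.sum_congr rfl fun j _ => ?_
        rw [Real.mul_rpow (hc j l) (Real.rpow_nonneg (hS j) _), mul_right_comm,
          ← Real.rpow_add_of_nonneg (hc j l) hθ0 hθ1, ← Real.rpow_mul (hS j),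
          add_sub_cancel, Real.rpow_one]
        congr 2
        linarith
    _ ≤ ∑ l, E l ^ θ * d l ^ (1 - θ) := Finset.sum_le_sum fun l _ =>
        sum_rpow_mul_rpow_le _ (fun j => mul_nonneg (hc j l) (Real.rpow_nonneg (hS j) _))
          (fun j => hc j l) hθ0 hθ1 (by ring)
    _ = ∑ l, (E l ^ (v / u)) ^ (θ * u / v) * (d l ^ (v / 2)) ^ ((1 - θ) * 2 / v) := by
        refine Finset.sum_congr rfl fun l _ => ?_
        rw [← Real.rpow_mul (hE l), ← Real.rpow_mul (hd l)]
        congr 2 <;> field_simp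
    _ ≤ (∑ l, E l ^ (v / u)) ^ (θ * u / v) * (∑ l, d l ^ (v / 2)) ^ ((1 - θ) * 2 / v) :=
        sum_rpow_mul_rpow_le _ (fun l => Real.rpow_nonneg (hE l) _)
          (fun l => Real.rpow_nonneg (hd l) _) (by positivity) (by positivity) hsum
    _ ≤ (M ^ v) ^ (θ * u / v) * (M ^ v) ^ ((1 - θ) * 2 / v) := by
        have hE' : 0 ≤ ∑ l, E l ^ (v / u) := Finset.sum_nonneg fun l _ => Real.rpow_nonneg (hE l) _
        have hd' : 0 ≤ ∑ l, d l ^ (v / 2) := Finset.sum_nonneg fun l _ => Real.rpow_nonneg (hd l) _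
        gcongr
    _ = M ^ v := by
        rw [← Real.rpow_add_of_nonneg (by positivity) (by positivity) (by positivity), hsum,
          Real.rpow_one]

theorem Fintype.sum_pi_fin_succ {α M : Type*} [Fintype α] [AddCommMonoid M] {n : ℕ}
    (F : (Fin (n + 1) → α) → M) :
    ∑ x, F x = ∑ a, ∑ x : Fin n → α, F (Fin.cons a x) := by
  rw [← (Fin.consEquiv fun _ => α).sum_comp, Fintype.sum_prod_type]
  rfl

theorem Fintype.expect_pi_fin_succ {α : Type*} [Fintype α] {n : ℕ} (F : (Fin (n + 1) → α) → ℝ) :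
    𝔼 x, F x = 𝔼 a, 𝔼 x : Fin n → α, F (Fin.cons a x) := by
  rw [← Fintype.expect_equiv (Fin.consEquiv fun _ => α) (fun x => F (Fin.cons x.1 x.2)) F
    (fun _ => rfl), ← Finset.univ_product_univ, Finset.expect_product]

theorem expect_units (F : ℤˣ → ℝ) : 𝔼 e, F e = (F 1 + F (-1)) / 2 := by
  rw [Fintype.expect_eq_sum_div_card]
  simp [UnitsInt.univ]

/-! ### Rademacher sums and Khinchine's inequality -/

section Signs

variable {𝕜 : Type*} [RCLike 𝕜]

/-- The Rademacher sum `∑ j, ε j • a j`. -/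
def signSum {n : ℕ} (ε : Fin n → ℤˣ) (a : Fin n → 𝕜) : 𝕜 := ∑ j, ((ε j : ℤ) : 𝕜) * a j

theorem norm_units_cast (e : ℤˣ) : ‖((e : ℤ) : 𝕜)‖ = 1 := by
  rcases Int.units_eq_one_or e with rfl | rfl <;> simp

theorem signSum_cons {n : ℕ} (e : ℤˣ) (ε : Fin n → ℤˣ) (a : Fin (n + 1) → 𝕜) :
    signSum (Fin.cons e ε : Fin (n + 1) → ℤˣ) a
      = ((e : ℤ) : 𝕜) * a 0 + signSum ε (fun j => a j.succ) := by
  simp [signSum, Fin.sum_univ_succ]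

theorem norm_add_sq_add_norm_sub_sq (x y : 𝕜) :
    ‖x + y‖ ^ 2 + ‖-x + y‖ ^ 2 = 2 * (‖x‖ ^ 2 + ‖y‖ ^ 2) := by
  have := parallelogram_law_with_norm ℝ y x
  rw [add_comm x y, neg_add_eq_sub]
  linarith

theorem expect_norm_signSum_sq {n : ℕ} (a : Fin n → 𝕜) :
    𝔼 ε : Fin n → ℤˣ, ‖signSum ε a‖ ^ 2 = ∑ j, ‖a j‖ ^ 2 := by
  induction n with
  | zero => simp [signSum]
  | succ n ih =>
    rw [Fintype.expect_pi_fin_succ, Finset.expect_comm, Fin.sum_univ_succ, ← ih fun j => a j.succ]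
    simp only [expect_units, signSum_cons]
    have : ∀ x : 𝕜, (‖((1 : ℤˣ) : ℤ) * a 0 + x‖ ^ 2 + ‖(((-1 : ℤˣ) : ℤ) : 𝕜) * a 0 + x‖ ^ 2) / 2
        = ‖a 0‖ ^ 2 + ‖x‖ ^ 2 := by
      intro x
      have := norm_add_sq_add_norm_sub_sq (a 0) x
      simp only [Units.val_one, Int.cast_one, one_mul, Units.val_neg, Int.cast_neg, neg_mul]
      linarith
    simp only [this, Finset.expect_add_distrib, Fintype.expect_const]

theorem expect_norm_signSum_pow_four_le {n : ℕ} (a : Fin n → 𝕜) :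
    𝔼 ε : Fin n → ℤˣ, ‖signSum ε a‖ ^ 4 ≤ 3 * (∑ j, ‖a j‖ ^ 2) ^ 2 := by
  induction n with
  | zero => simp [signSum]
  | succ n ih =>
    have ih := ih fun j => a j.succ
    rw [Fintype.expect_pi_fin_succ, Finset.expect_comm, Fin.sum_univ_succ]
    simp only [expect_units, signSum_cons]
    have key : ∀ x : 𝕜,
        (‖((1 : ℤˣ) : ℤ) * a 0 + x‖ ^ 4 + ‖(((-1 : ℤˣ) : ℤ) : 𝕜) * a 0 + x‖ ^ 4) / 2
          ≤ ‖a 0‖ ^ 4 + 6 * ‖a 0‖ ^ 2 * ‖x‖ ^ 2 + ‖x‖ ^ 4 := by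
      intro x
      have h1 := norm_add_sq_add_norm_sub_sq (a 0) x
      have h2 : ‖a 0 + x‖ ^ 2 ≤ (‖a 0‖ + ‖x‖) ^ 2 := by gcongr; exact norm_add_le _ _
      have h3 : ‖-a 0 + x‖ ^ 2 ≤ (‖a 0‖ + ‖x‖) ^ 2 := by
        gcongr; simpa using norm_add_le (-a 0) x
      simp only [Units.val_one, Int.cast_one, one_mul, Units.val_neg, Int.cast_neg, neg_mul]
      have e : ∀ t : ℝ, t ^ 4 = (t ^ 2) ^ 2 := fun t => by ring
      rw [e ‖a 0 + x‖, e ‖-a 0 + x‖]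
      set P := ‖a 0 + x‖ ^ 2
      set Q := ‖-a 0 + x‖ ^ 2
      have hQ : Q = 2 * (‖a 0‖ ^ 2 + ‖x‖ ^ 2) - P := by linarith
      rw [hQ] at h3 ⊢
      -- With N = (‖a 0‖ + ‖x‖)², (N - P)(N - Q) ≥ 0 bounds PQ from below, hence P² + Q² from above,
      -- since P + Q is known.
      nlinarith [mul_nonneg (sub_nonneg.2 h2) (sub_nonneg.2 h3)]
    calc _ ≤ 𝔼 ε : Fin n → ℤˣ, (‖a 0‖ ^ 4
            + 6 * ‖a 0‖ ^ 2 * ‖signSum ε fun j => a j.succ‖ ^ 2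
            + ‖signSum ε fun j => a j.succ‖ ^ 4) := Finset.expect_le_expect fun ε _ => key _
      _ = ‖a 0‖ ^ 4 + 6 * ‖a 0‖ ^ 2 * (∑ j : Fin n, ‖a j.succ‖ ^ 2)
            + 𝔼 ε : Fin n → ℤˣ, ‖signSum ε fun j => a j.succ‖ ^ 4 := by
          rw [Finset.expect_add_distrib, Finset.expect_add_distrib, Fintype.expect_const,
            ← Finset.mul_expect, expect_norm_signSum_sq]
      _ ≤ _ := by nlinarith [sq_nonneg (‖a 0‖ ^ 2)]

/-- Khinchine's inequality between the first and the second moment. -/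
theorem sqrt_sum_sq_le_expect_norm_signSum {n : ℕ} (a : Fin n → 𝕜) :
    √(∑ j, ‖a j‖ ^ 2) ≤ 2 * 𝔼 ε : Fin n → ℤˣ, ‖signSum ε a‖ := by
  have h2 := expect_norm_signSum_sq a
  have h4 := expect_norm_signSum_pow_four_le a
  set S := ∑ j, ‖a j‖ ^ 2
  have hS : 0 ≤ S := Finset.sum_nonneg fun j _ => by positivity
  have hE : 0 ≤ 𝔼 ε : Fin n → ℤˣ, ‖signSum ε a‖ :=
    Finset.expect_nonneg fun _ _ => norm_nonneg _
  rcases (Real.sqrt_nonneg S).eq_or_lt with h0 | hσ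
  · rw [← h0]; positivity
  set σ := √S
  have hσS : S = σ ^ 2 := (Real.sq_sqrt hS).symm
  -- A quartic minorant of the linear function, touching it at t = 2σ. Averaging it with the second
  -- and fourth moments gives 9σ⁴ ≤ 16σ³ 𝔼‖·‖, and 16/9 ≤ 2.
  have key : ∀ t : ℝ, 0 ≤ t → 12 * σ ^ 2 * t ^ 2 - t ^ 4 ≤ 16 * σ ^ 3 * t := by
    intro t ht
    have : 16 * σ ^ 3 * t - (12 * σ ^ 2 * t ^ 2 - t ^ 4) = t * (t - 2 * σ) ^ 2 * (t + 4 * σ) := by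
      ring
    have h0 : 0 ≤ t * (t - 2 * σ) ^ 2 * (t + 4 * σ) := by positivity
    linarith
  have h := Finset.expect_le_expect (s := Finset.univ)
    fun (ε : Fin n → ℤˣ) _ => key ‖signSum ε a‖ (norm_nonneg _)
  rw [Finset.expect_sub_distrib, ← Finset.mul_expect, ← Finset.mul_expect, h2, hσS] at h
  rw [hσS] at h4
  have h5 : σ ^ 3 * (9 * σ) ≤ σ ^ 3 * (16 * 𝔼 ε : Fin n → ℤˣ, ‖signSum ε a‖) := by
    nlinarith
  have := le_of_mul_le_mul_left h5 (by positivity)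
  linarith

/-- Minkowski's inequality for the average of Euclidean norms. -/
theorem sqrt_sum_sq_expect_le {Ω : Type*} [Fintype Ω] {n : ℕ} (X : Ω → Fin n → ℝ) :
    √(∑ j, (𝔼 ω, X ω j) ^ 2) ≤ 𝔼 ω, √(∑ j, X ω j ^ 2) := by
  set S := ∑ j, (𝔼 ω, X ω j) ^ 2
  have hS : 0 ≤ S := Finset.sum_nonneg fun j _ => by positivity
  have hE : 0 ≤ 𝔼 ω, √(∑ j, X ω j ^ 2) := Finset.expect_nonneg fun _ _ => Real.sqrt_nonneg _
  rcases (Real.sqrt_nonneg S).eq_or_lt with h0 | hσ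
  · rwa [← h0]
  refine le_of_mul_le_mul_left ?_ hσ
  rw [Real.mul_self_sqrt hS, Finset.mul_expect]
  calc S = 𝔼 ω, ∑ j, (𝔼 ω, X ω j) * X ω j := by
        rw [Finset.expect_sum_comm]
        exact Finset.sum_congr rfl fun j _ => by rw [← Finset.mul_expect, sq]
    _ ≤ _ := Finset.expect_le_expect fun ω _ => Real.sum_mul_le_sqrt_mul_sqrt _ _ _

/-- The iterated Khinchine inequality for multiple Rademacher sums. -/
theorem sqrt_sum_sq_le_expect_norm_multiple {n m : ℕ} (a : (Fin m → Fin n) → 𝕜) :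
    √(∑ J, ‖a J‖ ^ 2) ≤ 2 ^ m * 𝔼 ε : Fin m → Fin n → ℤˣ,
      ‖∑ J, a J * ∏ k, ((ε k (J k) : ℤ) : 𝕜)‖ := by
  induction m with
  | zero => simp
  | succ m ih =>
    set X : (Fin m → Fin n → ℤˣ) → Fin n → 𝕜 := fun ε j =>
      ∑ J : Fin m → Fin n, a (Fin.cons j J) * ∏ k, ((ε k (J k) : ℤ) : 𝕜) with hX
    have e : ∀ (ε₀ : Fin n → ℤˣ) (ε : Fin m → Fin n → ℤˣ),
        ∑ J, a J * ∏ k, (((Fin.cons ε₀ ε : Fin (m + 1) → Fin n → ℤˣ) k (J k) : ℤ) : 𝕜)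
          = signSum ε₀ (X ε) := by
      intro ε₀ ε
      rw [Fintype.sum_pi_fin_succ]
      refine Finset.sum_congr rfl fun j _ => ?_
      rw [hX, Finset.mul_sum]
      refine Finset.sum_congr rfl fun J _ => ?_
      rw [Fin.prod_univ_succ]
      simp only [Fin.cons_zero, Fin.cons_succ]
      ring
    rw [Fintype.expect_pi_fin_succ, Finset.expect_comm, Fintype.sum_pi_fin_succ]
    simp only [e]
    -- The inner indices are handled for each fixed j; Minkowski then moves the average outside the
    -- Euclidean norm over j, where the scalar inequality applies.
    have h1 : ∀ j, ∑ J : Fin m → Fin n, ‖a (Fin.cons j J)‖ ^ 2 ≤ (2 ^ m) ^ 2 * (𝔼 ε, ‖X ε j‖) ^ 2 := by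
      intro j
      have := ih fun J => a (Fin.cons j J)
      rw [← mul_pow]
      exact (Real.sqrt_le_left (mul_nonneg (by positivity)
        (Finset.expect_nonneg fun _ _ => norm_nonneg _))).1 this
    calc √(∑ j, ∑ J : Fin m → Fin n, ‖a (Fin.cons j J)‖ ^ 2)
        ≤ √((2 ^ m) ^ 2 * ∑ j, (𝔼 ε, ‖X ε j‖) ^ 2) := by
          rw [Finset.mul_sum]
          exact Real.sqrt_le_sqrt (Finset.sum_le_sum fun j _ => h1 j)
      _ = 2 ^ m * √(∑ j, (𝔼 ε, ‖X ε j‖) ^ 2) := by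
          rw [Real.sqrt_mul (by positivity), Real.sqrt_sq (by positivity)]
      _ ≤ 2 ^ m * 𝔼 ε, (2 * 𝔼 ε₀ : Fin n → ℤˣ, ‖signSum ε₀ (X ε)‖) := by
          gcongr
          exact (sqrt_sum_sq_expect_le fun ε j => ‖X ε j‖).trans
            (Finset.expect_le_expect fun ε _ => sqrt_sum_sq_le_expect_norm_signSum _)
      _ = _ := by rw [← Finset.mul_expect]; ring

theorem sum_rpow_le_rpow_sum {ι : Type*} (s : Finset ι) {x : ι → ℝ} (hx : ∀ i, 0 ≤ x i) {q : ℝ}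
    (hq : 1 ≤ q) : ∑ i ∈ s, x i ^ q ≤ (∑ i ∈ s, x i) ^ q := by
  have e : ∀ t : ℝ, 0 ≤ t → t ^ q = t * t ^ (q - 1) := by
    intro t ht
    nth_rewrite 2 [← Real.rpow_one t]
    rw [← Real.rpow_add_of_nonneg ht zero_le_one (by linarith), add_sub_cancel]
  rw [e _ (Finset.sum_nonneg fun i _ => hx i), Finset.sum_mul]
  refine Finset.sum_le_sum fun i hi => ?_
  rw [e _ (hx i)]
  exact mul_le_mul_of_nonneg_left (Real.rpow_le_rpow (hx i)
    (Finset.single_le_sum (fun i _ => hx i) hi) (by linarith)) (hx i)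

/-- A lower `s`-moment estimate with constant `1` implies the `q`-moment estimate for `q ≥ s`. -/
theorem sum_rpow_le_expect_rpow {Ω ι : Type*} [Fintype Ω] [Nonempty Ω] [Fintype ι] {X : Ω → ℝ}
    {x : ι → ℝ} (hX : ∀ ω, 0 ≤ X ω) (hx : ∀ j, 0 ≤ x j) {s q : ℝ} (hs : 0 < s) (hsq : s ≤ q)
    (h : ∑ j, x j ^ s ≤ 𝔼 ω, X ω ^ s) : ∑ j, x j ^ q ≤ 𝔼 ω, X ω ^ q := by
  have hq : 1 ≤ q / s := (one_le_div hs).2 hsq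
  have e : ∀ t : ℝ, 0 ≤ t → t ^ q = (t ^ s) ^ (q / s) := by
    intro t ht
    rw [← Real.rpow_mul ht]; congr 1; field_simp
  have hcard : (Fintype.card Ω : ℝ) ≠ 0 := by simp
  have em : ∀ F : Ω → ℝ, 𝔼 ω, F ω = ∑ ω, (Fintype.card Ω : ℝ)⁻¹ * F ω := by
    intro F
    rw [Fintype.expect_eq_sum_div_card, ← Finset.mul_sum, div_eq_inv_mul]
  calc ∑ j, x j ^ q = ∑ j, (x j ^ s) ^ (q / s) := Finset.sum_congr rfl fun j _ => e _ (hx j)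
    _ ≤ (∑ j, x j ^ s) ^ (q / s) :=
        sum_rpow_le_rpow_sum _ (fun j => Real.rpow_nonneg (hx j) _) hq
    _ ≤ (𝔼 ω, X ω ^ s) ^ (q / s) := Real.rpow_le_rpow
        (Finset.sum_nonneg fun j _ => Real.rpow_nonneg (hx j) _) h (by linarith)
    -- Jensen for the probability average; the previous inequality was ℓ_s ⊂ ℓ_q with norm 1.
    _ ≤ 𝔼 ω, (X ω ^ s) ^ (q / s) := by
        rw [em, em]
        exact Real.rpow_arith_mean_le_arith_mean_rpow _ _ _ (fun _ _ => by positivity)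
          (by simp) (fun ω _ => Real.rpow_nonneg (hX ω) _) hq
    _ = _ := Finset.expect_congr rfl fun ω _ => (e _ (hX ω)).symm

end Signs

/-! ### Mixed norms and their cotype -/

section MixedNorm

variable {𝕜 : Type*} [RCLike 𝕜] {n : ℕ}

theorem mixedNorm_nonneg {m : ℕ} (s : Fin m → ℝ≥0∞) (hs : ∀ k, s k ≠ 0)
    (f : (Fin m → Fin n) → 𝕜) : 0 ≤ mixedNorm s f := by
  cases m with
  | zero => exact norm_nonneg _
  | succ m =>
    rw [mixedNorm]
    rcases eq_or_ne (s 0) ∞ with h | h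
    · generalize s 0 = t at h
      subst h
      rw [PiLp.norm_eq_ciSup]
      exact Real.iSup_nonneg fun _ => norm_nonneg _
    · rw [PiLp.norm_eq_sum (ENNReal.toReal_pos (hs 0) h)]
      positivity

theorem mixedNorm_succ {m : ℕ} {s : Fin (m + 1) → ℝ≥0∞} (hs : ∀ k, s k ≠ 0) (h : s 0 ≠ ∞)
    (f : (Fin (m + 1) → Fin n) → 𝕜) :
    mixedNorm s f = (∑ j, mixedNorm (fun k => s k.succ) (fun J => f (Fin.cons j J))
      ^ (s 0).toReal) ^ (s 0).toReal⁻¹ := by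
  rw [mixedNorm, PiLp.norm_eq_sum (ENNReal.toReal_pos (hs 0) h), one_div]
  congr 1
  refine Finset.sum_congr rfl fun j _ => ?_
  rw [Real.norm_of_nonneg (mixedNorm_nonneg _ (fun k => hs k.succ) _)]

/-- Mixed norms with antitone exponents `≥ 2` have cotype `q` with constant `1` whenever `q` is at
least the largest exponent. -/
theorem sum_mixedNorm_rpow_le_expect {m N : ℕ} {σ : Fin m → ℝ} (hσ : Antitone σ)
    (hσ2 : ∀ k, 2 ≤ σ k) {q : ℝ} (hq2 : 2 ≤ q) (hq : ∀ k, σ k ≤ q)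
    (f : Fin N → (Fin m → Fin n) → 𝕜) :
    ∑ j, mixedNorm (fun k => ENNReal.ofReal (σ k)) (f j) ^ q ≤
      𝔼 ε : Fin N → ℤˣ, mixedNorm (fun k => ENNReal.ofReal (σ k))
        (fun J => signSum ε fun j => f j J) ^ q := by
  induction m generalizing q with
  | zero =>
    refine sum_rpow_le_expect_rpow (fun _ => norm_nonneg _) (fun _ => norm_nonneg _) two_pos hq2 ?_
    simp only [Real.rpow_two]
    exact (expect_norm_signSum_sq _).ge
  | succ m ih =>
    have h0 : ∀ k, ENNReal.ofReal (σ k) ≠ 0 := fun k => by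
      have := hσ2 k
      simp; linarith
    have hpos : 0 < σ 0 := by linarith [hσ2 0]
    -- It suffices to treat q = `σ 0`, for which the power of the norm is additive over the slices.
    -- Antitonicity then lets the induction hypothesis apply to each slice with this q.
    refine sum_rpow_le_expect_rpow (fun _ => mixedNorm_nonneg _ h0 _)
      (fun _ => mixedNorm_nonneg _ h0 _) (s := σ 0) hpos (hq 0) ?_
    have hN : ∀ g : (Fin (m + 1) → Fin n) → 𝕜,
        mixedNorm (fun k => ENNReal.ofReal (σ k)) g ^ σ 0 =
        ∑ j, mixedNorm (fun k : Fin m => ENNReal.ofReal (σ k.succ)) (fun J => g (Fin.cons j J))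
          ^ σ 0 := by
      intro g
      rw [mixedNorm_succ h0 ENNReal.ofReal_ne_top, ENNReal.toReal_ofReal hpos.le,
        Real.rpow_inv_rpow _ hpos.ne']
      exact Finset.sum_nonneg fun j _ =>
        Real.rpow_nonneg (mixedNorm_nonneg _ (fun k => h0 k.succ) _) _
    simp only [hN]
    rw [Finset.sum_comm, Finset.expect_sum_comm]
    refine Finset.sum_le_sum fun l _ => ?_
    exact ih (fun i j h => hσ (Fin.succ_le_succ_iff.2 h)) (fun k => hσ2 _) (hσ2 0)
      (fun k => hσ (Fin.zero_le _)) (fun j J => f j (Fin.cons l J))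

end MixedNorm

/-! ### Bounded forms: Littlewood's inequality and the weight trade -/

section FormBound

variable {𝕜 : Type*} [RCLike 𝕜] {n : ℕ}

/-- The form with coefficients `a` is bounded by `M` on the product of the unit balls of
`ℓ_{1 / r k}`, whose elements are written as `y ^ r k * z` with `y` in the positive part of the unit
ball of `ℓ₁` and `z` in the unit ball of `ℓ_∞`. -/
def FormBound {m : ℕ} (r : Fin m → ℝ) (a : (Fin m → Fin n) → 𝕜) (M : ℝ) : Prop :=
  ∀ (y : Fin m → Fin n → ℝ) (z : Fin m → Fin n → 𝕜), (∀ k j, 0 ≤ y k j) → (∀ k, ∑ j, y k j ≤ 1) →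
    (∀ k j, ‖z k j‖ ≤ 1) → ‖∑ J, a J * ∏ k, (((y k (J k) ^ r k : ℝ) : 𝕜) * z k (J k))‖ ≤ M

/-- Freezing the first variable at a vector of the unit ball keeps the bound. In the induction `z₀`
is a choice of signs. -/
theorem FormBound.slice {m : ℕ} {r : Fin (m + 1) → ℝ} {a : (Fin (m + 1) → Fin n) → 𝕜} {M : ℝ}
    (h : FormBound r a M) {y₀ : Fin n → ℝ} {z₀ : Fin n → 𝕜} (hy : ∀ j, 0 ≤ y₀ j)
    (hy1 : ∑ j, y₀ j ≤ 1) (hz : ∀ j, ‖z₀ j‖ ≤ 1) :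
    FormBound (fun k => r k.succ)
      (fun J => ∑ j, z₀ j * (((y₀ j ^ r 0 : ℝ) : 𝕜) * a (Fin.cons j J))) M := by
  intro y z hy' hy1' hz'
  have := h (Fin.cons y₀ y) (Fin.cons z₀ z) (Fin.cases hy hy') (Fin.cases hy1 hy1')
    (Fin.cases hz hz')
  refine le_of_eq_of_le ?_ this
  congr 1
  rw [Fintype.sum_pi_fin_succ, Finset.sum_comm]
  refine Finset.sum_congr rfl fun J _ => ?_
  rw [Finset.sum_mul]
  refine Finset.sum_congr rfl fun j _ => ?_
  rw [Fin.prod_univ_succ]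
  simp only [Fin.cons_zero, Fin.cons_succ]
  ring

/-- The Littlewood-type inequality for forms bounded on `ℓ_∞ × ⋯ × ℓ_∞`. -/
theorem sum_sqrt_sum_sq_le {m : ℕ} {a : (Fin m → Fin n) → 𝕜} {M : ℝ}
    (h : ∀ z : Fin m → Fin n → 𝕜, (∀ k j, ‖z k j‖ ≤ 1) → ‖∑ J, a J * ∏ k, z k (J k)‖ ≤ M)
    (k : Fin m) : ∑ j, √(∑ J, if J k = j then ‖a J‖ ^ 2 else 0) ≤ 2 ^ m * M := by
  set X : (Fin m → Fin n → ℤˣ) → Fin n → 𝕜 := fun ε j =>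
    ∑ J, (if J k = j then a J else 0) * ∏ k, ((ε k (J k) : ℤ) : 𝕜) with hX
  have hXM : ∀ ε, ∑ j, ‖X ε j‖ ≤ M := by
    intro ε
    -- The phases of the `X ε j` are absorbed into the k-th variable, so that ∑ j, ‖X ε j‖ becomes a
    -- value of the form.
    choose θ hθ hθX using fun j => RCLike.exists_norm_eq_mul_self (X ε j)
    have := h (fun l j => (if l = k then θ j else 1) * ((ε l j : ℤ) : 𝕜)) (by
      intro l j
      rw [norm_mul, norm_units_cast, mul_one]
      split_ifs <;> simp [hθ])
    have e : ∑ J, a J * ∏ l, ((if l = k then θ (J l) else 1) * ((ε l (J l) : ℤ) : 𝕜))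
        = ((∑ j, ‖X ε j‖ : ℝ) : 𝕜) := by
      rw [RCLike.ofReal_sum]
      simp only [hθX]
      simp only [hX, Finset.mul_sum]
      rw [Finset.sum_comm]
      refine Finset.sum_congr rfl fun J _ => ?_
      rw [Finset.prod_mul_distrib, Finset.prod_ite_eq' Finset.univ k fun l => θ (J l)]
      simp only [Finset.mem_univ, if_true, ite_mul, zero_mul, mul_ite, mul_zero,
        Finset.sum_ite_eq]
      ring
    rw [e, RCLike.norm_ofReal, abs_of_nonneg (Finset.sum_nonneg fun j _ => norm_nonneg _)] at this
    exact this
  calc ∑ j, √(∑ J, if J k = j then ‖a J‖ ^ 2 else 0)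
      ≤ ∑ j, 2 ^ m * 𝔼 ε, ‖X ε j‖ := by
        refine Finset.sum_le_sum fun j _ => ?_
        refine le_of_eq_of_le ?_
          (sqrt_sum_sq_le_expect_norm_multiple fun J => if J k = j then a J else 0)
        congr 1
        refine Finset.sum_congr rfl fun J _ => ?_
        split_ifs <;> simp
    _ = 2 ^ m * 𝔼 ε, ∑ j, ‖X ε j‖ := by rw [← Finset.mul_sum, Finset.expect_sum_comm]
    _ ≤ 2 ^ m * M := by
        gcongr
        exact Finset.expect_le Finset.univ_nonempty fun ε _ => hXM ε

/-- All k must be treated together: for k = l the weight factors out of the inner sum and is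
optimized directly, and that case supplies the exchanged-order bound needed for the other k. -/
theorem sum_rpow_le_of_forall_weighted_coord {m : ℕ} {B : (Fin m → Fin n) → ℝ} (hB : ∀ J, 0 ≤ B J)
    {M : ℝ} (hM : 0 ≤ M) {u v ρ : ℝ} (hu : 0 < u) (huv : u ≤ v) (hv : v ≤ 2)
    (h : v⁻¹ = u⁻¹ - ρ) (l : Fin m)
    (H : ∀ y : Fin n → ℝ, (∀ j, 0 ≤ y j) → ∑ j, y j ≤ 1 → ∀ k,
      ∑ j, (∑ J, if J k = j then B J * y (J l) ^ (2 * ρ) else 0) ^ (u / 2) ≤ M ^ u) (k : Fin m) :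
    ∑ j, (∑ J, if J k = j then B J else 0) ^ (v / 2) ≤ M ^ v := by
  have hsum : ∀ k j, 0 ≤ ∑ J, if J k = j then B J else 0 := fun k j =>
    Finset.sum_nonneg fun J _ => by split_ifs <;> simp [hB]
  have hl : ∑ j, (∑ J, if J l = j then B J else 0) ^ (v / 2) ≤ M ^ v := by
    have := sum_rpow_le_of_forall_weighted (D := fun j => √(∑ J, if J l = j then B J else 0))
      (fun j => Real.sqrt_nonneg _) hM hu (hu.trans_le huv) h ?_
    · refine le_of_eq_of_le (Finset.sum_congr rfl fun j _ => ?_) this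
      rw [Real.sqrt_eq_rpow, ← Real.rpow_mul (hsum l j)]
      congr 1; ring
    · intro y hy hy1
      refine le_of_eq_of_le (Finset.sum_congr rfl fun j _ => ?_) (H y hy hy1 l)
      have e : (∑ J, if J l = j then B J * y (J l) ^ (2 * ρ) else 0)
          = y j ^ (2 * ρ) * ∑ J, if J l = j then B J else 0 := by
        rw [Finset.mul_sum]
        refine Finset.sum_congr rfl fun J _ => ?_
        split_ifs with hJ
        · rw [hJ, mul_comm]
        · simp
      rw [e, Real.mul_rpow (Real.rpow_nonneg (hy j) _) (Real.sqrt_nonneg _),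
        Real.mul_rpow (Real.rpow_nonneg (hy j) _) (hsum l j), Real.sqrt_eq_rpow,
        ← Real.rpow_mul (hy j), ← Real.rpow_mul (hy j), ← Real.rpow_mul (hsum l j)]
      congr 2 <;> ring
  have e1 : ∀ (w : Fin n → ℝ) (j : Fin n),
      ∑ l', (∑ J, if J k = j ∧ J l = l' then B J else 0) * w l'
        = ∑ J, if J k = j then B J * w (J l) else 0 := by
    intro w j
    simp only [Finset.sum_mul]
    rw [Finset.sum_comm]
    refine Finset.sum_congr rfl fun J _ => ?_
    by_cases hJ : J k = j <;> simp [hJ]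
  have e2 : ∀ j, ∑ l', (∑ J, if J k = j ∧ J l = l' then B J else 0)
      = ∑ J, if J k = j then B J else 0 := fun j => by simpa using e1 1 j
  have e3 : ∀ l', ∑ j, (∑ J, if J k = j ∧ J l = l' then B J else 0)
      = ∑ J, if J l = l' then B J else 0 := by
    intro l'
    rw [Finset.sum_comm]
    refine Finset.sum_congr rfl fun J _ => ?_
    by_cases hJ : J l = l' <;> simp [hJ]
  have := sum_rpow_le_of_forall_weighted_inner
    (c := fun j l' => ∑ J, if J k = j ∧ J l = l' then B J else 0)
    (fun j l' => Finset.sum_nonneg fun J _ => by split_ifs <;> simp [hB]) hM hu huv hv h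
    (fun y hy hy1 => by simpa only [e1] using H y hy hy1 k) (by simpa only [e3] using hl)
  simpa only [e2] using this

/-- The Hardy-Littlewood trade: weights from `ℓ_{1 / r l}`, `l ∈ T`, are removed at the cost of
lowering `1 / u` by `∑ l ∈ T, r l`, as long as the resulting exponent is at most `2`. -/
theorem sum_rpow_le_of_forall_weighted_finset {m : ℕ} (T : Finset (Fin m)) {r : Fin m → ℝ}
    (hr : ∀ k, 0 ≤ r k) {B : (Fin m → Fin n) → ℝ} (hB : ∀ J, 0 ≤ B J) {M : ℝ} (hM : 0 ≤ M)
    {u v : ℝ} (hv0 : 0 < v) (hv : v ≤ 2) (h : v⁻¹ = u⁻¹ - ∑ l ∈ T, r l)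
    (H : ∀ y : Fin m → Fin n → ℝ, (∀ k j, 0 ≤ y k j) → (∀ k, ∑ j, y k j ≤ 1) → ∀ k,
      ∑ j, (∑ J, if J k = j then B J * ∏ l ∈ T, y l (J l) ^ (2 * r l) else 0) ^ (u / 2) ≤ M ^ u)
    (k : Fin m) : ∑ j, (∑ J, if J k = j then B J else 0) ^ (v / 2) ≤ M ^ v := by
  induction T using Finset.induction_on generalizing B v k with
  | empty =>
    obtain rfl : v = u := by simpa using h
    simpa using H 0 (by simp) (by simp) k
  | insert l T hl ih =>
    rw [Finset.sum_insert hl] at h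
    have hv' : 0 < v⁻¹ := inv_pos.2 hv0
    have hw : 0 < v⁻¹ + r l := by linarith [hr l]
    have hwv : (v⁻¹ + r l)⁻¹ ≤ v := by
      rw [inv_le_comm₀ hw hv0]; linarith [hr l]
    -- The weight of `l` is frozen into `B` while those of `T` are removed, which leads from u to
    -- (v⁻¹ + r l)⁻¹. Removing it then leads to v, and the intermediate exponent is at most v ≤ 2.
    refine sum_rpow_le_of_forall_weighted_coord (u := (v⁻¹ + r l)⁻¹) (ρ := r l) hB hM
      (inv_pos.2 hw) hwv hv (by rw [inv_inv]; ring) l (fun y₀ hy₀ hy₀1 k => ?_) k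
    refine ih (fun J => mul_nonneg (hB J) (Real.rpow_nonneg (hy₀ _) _)) (inv_pos.2 hw)
      (hwv.trans hv) (by rw [inv_inv, h]; ring) (fun y hy hy1 k => ?_) k
    refine le_of_eq_of_le ?_ (H (Function.update y l y₀) ?_ ?_ k)
    · refine Finset.sum_congr rfl fun j _ => ?_
      congr 1
      refine Finset.sum_congr rfl fun J _ => ?_
      have e : ∏ l' ∈ T, Function.update y l y₀ l' (J l') ^ (2 * r l')
          = ∏ l' ∈ T, y l' (J l') ^ (2 * r l') := by
        refine Finset.prod_congr rfl fun l' hl' => ?_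
        rw [Function.update_of_ne (by rintro rfl; exact hl hl')]
      rw [Finset.prod_insert hl, e, Function.update_self, mul_assoc]
    · intro k j
      rcases eq_or_ne k l with rfl | hk
      · simpa using hy₀ j
      · simpa [hk] using hy k j
    · intro k
      rcases eq_or_ne k l with rfl | hk
      · simpa using hy₀1
      · simpa [hk] using hy1 k

theorem mixedNorm_two {m : ℕ} (f : (Fin m → Fin n) → 𝕜) :
    mixedNorm (fun _ => ENNReal.ofReal 2) f = √(∑ J, ‖f J‖ ^ 2) := by
  induction m with
  | zero => simp [mixedNorm, Subsingleton.elim (default : Fin 0 → Fin n) Fin.elim0]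
  | succ m ih =>
    rw [mixedNorm_succ (by simp) ENNReal.ofReal_ne_top, Fintype.sum_pi_fin_succ,
      Real.sqrt_eq_rpow, ENNReal.toReal_ofReal zero_le_two, one_div]
    congr 1
    refine Finset.sum_congr rfl fun j _ => ?_
    rw [ih, Real.rpow_two, Real.sq_sqrt (Finset.sum_nonneg fun J _ => by positivity)]

theorem mixedNorm_mul_left {m : ℕ} {s : Fin m → ℝ≥0∞} (hs : ∀ k, s k ≠ 0) (hs' : ∀ k, s k ≠ ∞)
    (c : 𝕜) (f : (Fin m → Fin n) → 𝕜) :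
    mixedNorm s (fun J => c * f J) = ‖c‖ * mixedNorm s f := by
  induction m with
  | zero => exact norm_mul _ _
  | succ m ih =>
    have hpos := ENNReal.toReal_pos (hs 0) (hs' 0)
    have h := mixedNorm_nonneg (𝕜 := 𝕜) (n := n) _ fun k : Fin m => hs k.succ
    simp only [mixedNorm_succ hs (hs' 0), ih (fun k => hs k.succ) fun k => hs' k.succ,
      Real.mul_rpow (norm_nonneg c) (h _), ← Finset.mul_sum]
    rw [Real.mul_rpow (by positivity) (Finset.sum_nonneg fun j _ => Real.rpow_nonneg (h _) _),
      Real.rpow_rpow_inv (norm_nonneg c) hpos.ne']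

theorem mixedNorm_le_of_sum_rpow_le {m : ℕ} {σ : Fin (m + 1) → ℝ} (hσ : ∀ k, 0 < σ k)
    {f : (Fin (m + 1) → Fin n) → 𝕜} {M : ℝ} (hM : 0 ≤ M)
    (h : ∑ j, mixedNorm (fun k : Fin m => ENNReal.ofReal (σ k.succ)) (fun J => f (Fin.cons j J))
      ^ σ 0 ≤ M ^ σ 0) :
    mixedNorm (fun k => ENNReal.ofReal (σ k)) f ≤ M := by
  have h0 : ∀ k, ENNReal.ofReal (σ k) ≠ 0 := fun k => by simpa using hσ k
  rw [mixedNorm_succ h0 ENNReal.ofReal_ne_top, ENNReal.toReal_ofReal (hσ 0).le]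
  refine (Real.rpow_le_rpow (Finset.sum_nonneg fun j _ => Real.rpow_nonneg
    (mixedNorm_nonneg _ (fun k => h0 k.succ) _) _) h (inv_nonneg.2 (hσ 0).le)).trans_eq ?_
  rw [Real.rpow_rpow_inv hM (hσ 0).ne']

/-- The case in which the distinguished index is the first one. -/
theorem FormBound.mixedNorm_le_of_zero {m : ℕ} {r : Fin (m + 1) → ℝ} (hr : ∀ k, 0 ≤ r k)
    (hr1 : ∑ k, r k < 1) (hr2 : 1 / 2 ≤ r 0) {a : (Fin (m + 1) → Fin n) → 𝕜} {M : ℝ}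
    (hM : 0 ≤ M) (ha : FormBound r a M) {σ : Fin (m + 1) → ℝ} (hσ0 : σ 0 = (1 - ∑ k, r k)⁻¹)
    (hσ : ∀ k : Fin m, σ k.succ = 2) :
    mixedNorm (fun k => ENNReal.ofReal (σ k)) a ≤ 2 ^ (m + 1) * M := by
  have hσ0' : 0 < σ 0 := by rw [hσ0]; exact inv_pos.2 (by linarith)
  have hM' : 0 ≤ 2 ^ (m + 1) * M := by positivity
  refine mixedNorm_le_of_sum_rpow_le (Fin.cases hσ0' fun k => by simp [hσ]) hM' ?_
  simp only [hσ, mixedNorm_two]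
  set T : Finset (Fin (m + 1)) := Finset.univ.erase 0 with hT
  have hrT : r 0 + ∑ l ∈ T, r l = ∑ k, r k := Finset.add_sum_erase _ _ (Finset.mem_univ _)
  -- Here `r 0 ≥ 1 / 2` forces the other r to sum to less than 1/2, which gives v ≤ 2.
  set v := (1 - ∑ l ∈ T, r l)⁻¹ with hv
  have hv0 : 0 < v := inv_pos.2 (by linarith)
  have hv2 : v ≤ 2 := by
    rw [hv, inv_le_comm₀ (by linarith) two_pos]; linarith
  refine sum_rpow_le_of_forall_weighted (fun j => Real.sqrt_nonneg _) hM' hv0 hσ0' (r := r 0)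
    (by rw [hσ0, hv, inv_inv, inv_inv, ← hrT]; ring) fun y₀ hy₀ hy₀1 => ?_
  -- The trade starts from u = 1, the Littlewood exponent. The weight `y₀` stays inside `B`, because
  -- its removal may push the exponent above 2.
  have key := sum_rpow_le_of_forall_weighted_finset T hr
    (B := fun J => ‖a J‖ ^ 2 * y₀ (J 0) ^ (2 * r 0))
    (fun J => mul_nonneg (by positivity) (Real.rpow_nonneg (hy₀ _) _)) hM' hv0 hv2 (u := 1)
    (by rw [hv, inv_inv, inv_one]) (fun y hy hy1 k => ?_) 0
  · refine le_of_eq_of_le (Finset.sum_congr rfl fun j _ => ?_) key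
    have e : (∑ J : Fin (m + 1) → Fin n, if J 0 = j then ‖a J‖ ^ 2 * y₀ (J 0) ^ (2 * r 0) else 0)
        = y₀ j ^ (2 * r 0) * ∑ J, ‖a (Fin.cons j J)‖ ^ 2 := by
      rw [Fintype.sum_pi_fin_succ, Finset.mul_sum, Finset.sum_comm]
      refine Finset.sum_congr rfl fun J _ => ?_
      simp [mul_comm]
    have hs : 0 ≤ ∑ J : Fin m → Fin n, ‖a (Fin.cons j J)‖ ^ 2 :=
      Finset.sum_nonneg fun J _ => by positivity
    rw [e, Real.mul_rpow (Real.rpow_nonneg (hy₀ j) _) (Real.sqrt_nonneg _),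
      Real.mul_rpow (Real.rpow_nonneg (hy₀ j) _) hs, Real.sqrt_eq_rpow,
      ← Real.rpow_mul (hy₀ j), ← Real.rpow_mul (hy₀ j), ← Real.rpow_mul hs]
    congr 2 <;> ring
  · set y' := Function.update y 0 y₀ with hy'
    have hy'0 : ∀ k j, 0 ≤ y' k j := by
      intro k j
      rcases eq_or_ne k 0 with rfl | hk
      · simpa [hy'] using hy₀ j
      · simpa [hy', hk] using hy k j
    have hy'1 : ∀ k, ∑ j, y' k j ≤ 1 := by
      intro k
      rcases eq_or_ne k 0 with rfl | hk
      · simpa [hy'] using hy₀1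
      · simpa [hy', hk] using hy1 k
    have := sum_sqrt_sum_sq_le (a := fun J => a J * ∏ k, ((y' k (J k) ^ r k : ℝ) : 𝕜)) (M := M)
      (fun z hz => by
        refine le_of_eq_of_le ?_ (ha y' z hy'0 hy'1 hz)
        congr 1
        refine Finset.sum_congr rfl fun J _ => ?_
        rw [Finset.prod_mul_distrib, mul_assoc]) k
    rw [Real.rpow_one]
    refine le_of_eq_of_le (Finset.sum_congr rfl fun j _ => ?_) this
    rw [← Real.sqrt_eq_rpow]
    congr 1
    refine Finset.sum_congr rfl fun J _ => ?_
    have e : ∏ l ∈ T, y' l (J l) ^ (2 * r l) = ∏ l ∈ T, y l (J l) ^ (2 * r l) := by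
      refine Finset.prod_congr rfl fun l hl => ?_
      rw [hy', Function.update_of_ne (Finset.ne_of_mem_erase hl)]
    have e' : ∀ k, (y' k (J k) ^ r k) ^ 2 = y' k (J k) ^ (2 * r k) := by
      intro k
      rw [← Real.rpow_natCast, ← Real.rpow_mul (hy'0 _ _), mul_comm]; norm_num
    congr 1
    rw [norm_mul, norm_prod, mul_pow, ← Finset.prod_pow]
    simp only [RCLike.norm_ofReal, sq_abs, e']
    rw [← Finset.mul_prod_erase _ _ (Finset.mem_univ (0 : Fin (m + 1))), ← hT, e, hy',
      Function.update_self, mul_assoc]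

/-- Linear forms: the duality between `ℓ_{1 / r}` and `ℓ_{1 / (1 - r)}`. -/
theorem FormBound.mixedNorm_le_of_one {r : Fin 1 → ℝ} (hr1 : r 0 < 1)
    {a : (Fin 1 → Fin n) → 𝕜} {M : ℝ} (hM : 0 ≤ M) (ha : FormBound r a M) {σ : Fin 1 → ℝ}
    (hσ0 : σ 0 = (1 - r 0)⁻¹) :
    mixedNorm (fun k => ENNReal.ofReal (σ k)) a ≤ M := by
  have hσ0' : 0 < σ 0 := by rw [hσ0]; exact inv_pos.2 (by linarith)
  refine mixedNorm_le_of_sum_rpow_le (Fin.cases hσ0' fun k => k.elim0) hM ?_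
  refine sum_rpow_le_of_forall_weighted (fun j => norm_nonneg _) hM one_pos hσ0' (r := r 0)
    (by rw [hσ0, inv_inv, inv_one]) fun y hy hy1 => ?_
  simp only [Real.rpow_one]
  choose θ hθ hθX using fun j => RCLike.exists_norm_eq_mul_self (a (Fin.cons j Fin.elim0))
  have := ha (fun _ => y) (fun _ => θ) (fun _ => hy) (fun _ => hy1) (fun _ j => (hθ j).le)
  rw [Fintype.sum_pi_fin_succ] at this
  simp only [Fintype.sum_unique, Fin.prod_univ_one, Fin.cons_zero,
    Subsingleton.elim (default : Fin 0 → Fin n) Fin.elim0] at this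
  have e : ∑ j, a (Fin.cons j Fin.elim0) * (((y j ^ r 0 : ℝ) : 𝕜) * θ j)
      = ((∑ j, y j ^ r 0 * ‖a (Fin.cons j Fin.elim0)‖ : ℝ) : 𝕜) := by
    rw [RCLike.ofReal_sum]
    refine Finset.sum_congr rfl fun j _ => ?_
    rw [RCLike.ofReal_mul, hθX]; ring
  rw [e, RCLike.norm_ofReal] at this
  exact (le_abs_self _).trans this

/-! ### The exponents and the induction on the number of variables -/

/-- The exponents `hlExponent`, as real numbers, in terms of `r k = 1 / p k`. -/
noncomputable def realExponent {m : ℕ} (r : Fin m → ℝ) (i k : Fin m) : ℝ :=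
  if k ≤ i then (1 - ∑ j ∈ Finset.Ici k, r j)⁻¹ else 2

theorem realExponent_succ_succ {m : ℕ} (r : Fin (m + 1) → ℝ) (i k : Fin m) :
    realExponent r i.succ k.succ = realExponent (fun k => r k.succ) i k := by
  simp only [realExponent, Fin.succ_le_succ_iff, ← Fin.map_succEmb_Ici, Finset.sum_map]
  rfl

theorem realExponent_zero {m : ℕ} (r : Fin (m + 1) → ℝ) (i : Fin (m + 1)) :
    realExponent r i 0 = (1 - ∑ k, r k)⁻¹ := by
  rw [realExponent, if_pos (Fin.zero_le i)]
  congr 3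
  exact Finset.Ici_bot

theorem sum_Ici_le_sum {m : ℕ} {r : Fin m → ℝ} (hr : ∀ k, 0 ≤ r k) (k : Fin m) :
    ∑ j ∈ Finset.Ici k, r j ≤ ∑ j, r j :=
  Finset.sum_le_sum_of_subset_of_nonneg (Finset.subset_univ _) fun j _ _ => hr j

theorem two_le_realExponent {m : ℕ} {r : Fin m → ℝ} (hr : ∀ k, 0 ≤ r k) (hr1 : ∑ k, r k < 1)
    {i : Fin m} (hi : 1 / 2 ≤ r i) (k : Fin m) : 2 ≤ realExponent r i k := by
  rw [realExponent]
  split_ifs with hk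
  · have h1 := sum_Ici_le_sum hr k
    have h2 : r i ≤ ∑ j ∈ Finset.Ici k, r j :=
      Finset.single_le_sum (fun j _ => hr j) (Finset.mem_Ici.2 hk)
    rw [le_inv_comm₀ two_pos (by linarith)]
    linarith
  · exact le_rfl

/-- Required by the cotype estimate. At the jump from k ≤ i to the value 2, it is r i ≥ 1/2 that
keeps the order. -/
theorem realExponent_antitone {m : ℕ} {r : Fin m → ℝ} (hr : ∀ k, 0 ≤ r k) (hr1 : ∑ k, r k < 1)
    {i : Fin m} (hi : 1 / 2 ≤ r i) : Antitone (realExponent r i) := by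
  intro k l hkl
  by_cases hl : l ≤ i
  · have h1 := sum_Ici_le_sum hr k
    have h2 : ∑ j ∈ Finset.Ici l, r j ≤ ∑ j ∈ Finset.Ici k, r j :=
      Finset.sum_le_sum_of_subset_of_nonneg (Finset.Ici_subset_Ici.2 hkl) fun j _ _ => hr j
    rw [realExponent, realExponent, if_pos hl, if_pos (hkl.trans hl)]
    exact inv_anti₀ (by linarith) (by linarith)
  · rw [realExponent, if_neg hl]
    exact two_le_realExponent hr hr1 hi k

theorem realExponent_le {m : ℕ} {r : Fin m → ℝ} (hr : ∀ k, 0 ≤ r k) (hr1 : ∑ k, r k < 1)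
    {i : Fin m} (hi : 1 / 2 ≤ r i) (k : Fin m) : realExponent r i k ≤ (1 - ∑ k, r k)⁻¹ := by
  cases m with
  | zero => exact i.elim0
  | succ m =>
    rw [← realExponent_zero r i]
    exact realExponent_antitone hr hr1 hi (Fin.zero_le k)

/-- The anisotropic Hardy-Littlewood inequality for coefficient arrays. -/
theorem FormBound.mixedNorm_le {m : ℕ} {r : Fin m → ℝ} (hr : ∀ k, 0 ≤ r k) (hr1 : ∑ k, r k < 1)
    {i : Fin m} (hi : 1 / 2 ≤ r i) {C : ℝ} (hC : 1 ≤ C) (hCi : (i : ℕ) + 1 = m ∨ 2 ^ m ≤ C)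
    {a : (Fin m → Fin n) → 𝕜} {M : ℝ} (hM : 0 ≤ M) (ha : FormBound r a M) :
    mixedNorm (fun k => ENNReal.ofReal (realExponent r i k)) a ≤ C * M := by
  induction m with
  | zero => exact i.elim0
  | succ m ih =>
    cases i using Fin.cases with
    | zero =>
      rcases hCi with h | h
      · obtain rfl : m = 0 := by simpa using h.symm
        have e : ∑ k, r k = r 0 := by simp
        refine (FormBound.mixedNorm_le_of_one (by linarith) hM ha ?_).trans
          (le_mul_of_one_le_left hM hC)
        rw [realExponent_zero, e]
      · refine (FormBound.mixedNorm_le_of_zero hr hr1 hi hM ha (realExponent_zero r 0)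
          fun k => ?_).trans (mul_le_mul_of_nonneg_right h hM)
        rw [realExponent, if_neg (by simp)]
    | succ i =>
      have hsum := Fin.sum_univ_succ r
      have hr1' : ∑ k : Fin m, r k.succ < 1 := by linarith [hr 0]
      have hr' : ∀ k : Fin m, 0 ≤ r k.succ := fun k => hr _
      have hσ2 := two_le_realExponent hr' hr1' (i := i) hi
      set q := (1 - ∑ k : Fin m, r k.succ)⁻¹ with hq
      have hqσ : ∀ k, realExponent (fun k => r k.succ) i k ≤ q := realExponent_le hr' hr1' hi
      have hq2 : 2 ≤ q := (hσ2 i).trans (hqσ i)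
      have hCM : 0 ≤ C * M := by positivity
      have hσ0 : ∀ k, 0 < realExponent r i.succ k := fun k =>
        two_pos.trans_le (two_le_realExponent hr hr1 hi k)
      refine mixedNorm_le_of_sum_rpow_le hσ0 hCM ?_
      have hN : ∀ f : (Fin m → Fin n) → 𝕜,
          0 ≤ mixedNorm (fun k => ENNReal.ofReal (realExponent (fun k => r k.succ) i k)) f :=
        mixedNorm_nonneg _ fun k => by have := hσ2 k; simp; linarith
      simp only [realExponent_succ_succ]
      refine sum_rpow_le_of_forall_weighted (fun j => hN _) hCM (two_pos.trans_le hq2)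
        (hσ0 0) (r := r 0) (by rw [realExponent_zero, hq, inv_inv, inv_inv, hsum]; ring)
        fun y hy hy1 => ?_
      have hsmul : ∀ j, mixedNorm
          (fun k => ENNReal.ofReal (realExponent (fun k => r k.succ) i k))
          (fun J => ((y j ^ r 0 : ℝ) : 𝕜) * a (Fin.cons j J)) = y j ^ r 0 * mixedNorm
          (fun k => ENNReal.ofReal (realExponent (fun k => r k.succ) i k))
          (fun J => a (Fin.cons j J)) := by
        intro j
        rw [mixedNorm_mul_left (fun k => by have := hσ2 k; simp; linarith)
          fun k => ENNReal.ofReal_ne_top, RCLike.norm_ofReal,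
          abs_of_nonneg (Real.rpow_nonneg (hy j) _)]
      simp only [← hsmul]
      -- Cotype q bounds the weighted slices by an average over signs, and each term of it is the
      -- mixed norm of a slice with bound M. The same C serves at every stage.
      refine (sum_mixedNorm_rpow_le_expect (realExponent_antitone hr' hr1' hi) hσ2 hq2 hqσ _).trans
        (Finset.expect_le Finset.univ_nonempty fun ε _ => ?_)
      refine Real.rpow_le_rpow (hN _) ?_ (by linarith)
      refine ih hr' hr1' hi ?_ ?_
      · refine hCi.imp (fun h => by simpa using h) fun h => le_trans ?_ h
        exact pow_le_pow_right₀ one_le_two (Nat.le_succ m)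
      · exact ha.slice hy hy1 fun j => (norm_units_cast (ε j)).le

end FormBound

/-! ### Unit balls of ℓ_p in terms of weights -/

section PiLpBall

variable {𝕜 : Type*} [RCLike 𝕜] {n : ℕ} {p : ℝ≥0∞} [Fact (1 ≤ p)]

theorem PiLp.exists_weight (z : PiLp p fun _ : Fin n => 𝕜) :
    ∃ y : Fin n → ℝ, (∀ j, 0 ≤ y j) ∧ ∑ j, y j ≤ 1 ∧ ∀ j, ‖z j‖ ≤ ‖z‖ * y j ^ p⁻¹.toReal := by
  rcases eq_or_ne p ∞ with rfl | hp
  -- For p = ∞ the exponent is 0 and 0 ^ 0 = 1, so the zero weight suffices.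
  · exact ⟨0, by simp, by simp, fun j => by simpa using PiLp.norm_apply_le z j⟩
  have hP : 0 < p.toReal := ENNReal.toReal_pos (one_pos.trans_le Fact.out).ne' hp
  rcases (norm_nonneg z).eq_or_lt with h0 | hz
  · exact ⟨0, by simp, by simp, fun j => by simpa [← h0] using PiLp.norm_apply_le z j⟩
  refine ⟨fun j => (‖z j‖ / ‖z‖) ^ p.toReal, fun j => by positivity, ?_, fun j => ?_⟩
  · have e : ∀ j, (‖z j‖ / ‖z‖) ^ p.toReal = ‖z j‖ ^ p.toReal / ‖z‖ ^ p.toReal := fun j =>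
      Real.div_rpow (norm_nonneg _) (norm_nonneg _) _
    have e' : ‖z‖ ^ p.toReal = ∑ j, ‖z j‖ ^ p.toReal := by
      rw [PiLp.norm_eq_sum hP, one_div, Real.rpow_inv_rpow (by positivity) hP.ne']
    simp only [e]
    rw [← Finset.sum_div, ← e', div_self (by positivity)]
  · rw [ENNReal.toReal_inv, Real.rpow_rpow_inv (by positivity) hP.ne', mul_div_cancel₀ _ hz.ne']

theorem PiLp.norm_weighted_le_one {y : Fin n → ℝ} {z : Fin n → 𝕜} (hy : ∀ j, 0 ≤ y j)
    (hy1 : ∑ j, y j ≤ 1) (hz : ∀ j, ‖z j‖ ≤ 1) :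
    ‖(WithLp.toLp p fun j => ((y j ^ p⁻¹.toReal : ℝ) : 𝕜) * z j : PiLp p fun _ : Fin n => 𝕜)‖
      ≤ 1 := by
  rcases eq_or_ne p ∞ with rfl | hp
  · rw [PiLp.norm_eq_ciSup]
    refine Real.iSup_le (fun j => ?_) zero_le_one
    simpa using hz j
  have hP : 0 < p.toReal := ENNReal.toReal_pos (one_pos.trans_le Fact.out).ne' hp
  rw [PiLp.norm_eq_sum hP]
  refine Real.rpow_le_one (by positivity) (le_trans (Finset.sum_le_sum fun j _ => ?_) hy1)
    (by positivity)
  calc ‖((y j ^ p⁻¹.toReal : ℝ) : 𝕜) * z j‖ ^ p.toReal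
      ≤ (y j ^ p⁻¹.toReal * 1) ^ p.toReal := by
        rw [norm_mul, RCLike.norm_ofReal, abs_of_nonneg (Real.rpow_nonneg (hy j) _)]
        have := Real.rpow_nonneg (hy j) p⁻¹.toReal
        gcongr
        exact hz j
    _ = y j := by
        rw [mul_one, ENNReal.toReal_inv, Real.rpow_inv_rpow (hy j) hP.ne']

end PiLpBall

/-! ### From continuous multilinear forms to coefficient arrays -/

section Main

variable {𝕜 : Type*} [RCLike 𝕜] {n m : ℕ} {p : Fin m → ℝ≥0∞} [∀ k, Fact (1 ≤ p k)]

theorem ContinuousMultilinearMap.formBound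
    (A : ContinuousMultilinearMap 𝕜 (fun k : Fin m => PiLp (p k) (fun _ : Fin n => 𝕜)) 𝕜) :
    FormBound (fun k => (p k)⁻¹.toReal)
      (fun J => A fun k => WithLp.toLp (p k) (Pi.single (J k) (1 : 𝕜))) ‖A‖ := by
  intro y z hy hy1 hz
  set x : ∀ k, PiLp (p k) fun _ : Fin n => 𝕜 := fun k =>
    WithLp.toLp (p k) fun j => ((y k j ^ (p k)⁻¹.toReal : ℝ) : 𝕜) * z k j with hx
  have e : x = fun k => ∑ j, (((y k j ^ (p k)⁻¹.toReal : ℝ) : 𝕜) * z k j) •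
      (WithLp.toLp (p k) (Pi.single j (1 : 𝕜)) : PiLp (p k) fun _ : Fin n => 𝕜) := by
    funext k
    ext j
    simp [hx, Pi.single_apply]
  have key : ‖A x‖ ≤ ‖A‖ := by
    refine (A.le_opNorm x).trans (mul_le_of_le_one_right (norm_nonneg _) ?_)
    exact Finset.prod_le_one (fun _ _ => norm_nonneg _)
      fun k _ => PiLp.norm_weighted_le_one (hy k) (hy1 k) (hz k)
  refine le_of_eq_of_le ?_ key
  rw [e, ContinuousMultilinearMap.map_sum]
  congr 1
  refine Finset.sum_congr rfl fun J _ => ?_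
  rw [ContinuousMultilinearMap.map_smul_univ, smul_eq_mul, mul_comm]

theorem toReal_inv_exponent (k : Fin m) : (p k)⁻¹ = ENNReal.ofReal (p k)⁻¹.toReal := by
  have : p k ≠ 0 := (one_pos.trans_le (Fact.out : 1 ≤ p k)).ne'
  rw [ENNReal.ofReal_toReal (by simpa using this)]

theorem sum_inv_exponent (T : Finset (Fin m)) :
    ∑ k ∈ T, (p k)⁻¹ = ENNReal.ofReal (∑ k ∈ T, (p k)⁻¹.toReal) := by
  rw [ENNReal.ofReal_sum_of_nonneg fun _ _ => ENNReal.toReal_nonneg]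
  exact Finset.sum_congr rfl fun k _ => toReal_inv_exponent k

theorem sum_toReal_inv_lt_one (h : ∑ k, (p k)⁻¹ < 1) : ∑ k, (p k)⁻¹.toReal < 1 := by
  rwa [sum_inv_exponent, ← ENNReal.ofReal_one, ENNReal.ofReal_lt_ofReal_iff one_pos] at h

theorem hlExponent_eq (h : ∑ k, (p k)⁻¹ < 1) (i k : Fin m) :
    hlExponent p i k = ENNReal.ofReal (realExponent (fun k => (p k)⁻¹.toReal) i k) := by
  have h1 := sum_toReal_inv_lt_one h
  have h2 := sum_Ici_le_sum (r := fun k => (p k)⁻¹.toReal) (fun _ => ENNReal.toReal_nonneg) k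
  rw [hlExponent, realExponent]
  split_ifs
  · rw [ENNReal.ofReal_inv_of_pos (by linarith), ENNReal.ofReal_sub _
      (Finset.sum_nonneg fun _ _ => ENNReal.toReal_nonneg), sum_inv_exponent, ENNReal.ofReal_one]
  · simp

theorem hardyLittlewoodInequality_of_le {i : Fin m} (h : ∑ k, (p k)⁻¹ < 1) (hi : p i ≤ 2) {C : ℝ}
    (hC : 1 ≤ C) (hCi : (i : ℕ) + 1 = m ∨ 2 ^ m ≤ C) :
    HardyLittlewoodInequality 𝕜 p (hlExponent p i) C := by
  intro n _ A
  have e : hlExponent p i = fun k =>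
      ENNReal.ofReal (realExponent (fun k => (p k)⁻¹.toReal) i k) := funext (hlExponent_eq h i)
  rw [e]
  refine FormBound.mixedNorm_le (fun _ => ENNReal.toReal_nonneg) (sum_toReal_inv_lt_one h) ?_ hC hCi
    (norm_nonneg A) A.formBound
  have hp : p i ≠ 0 := (one_pos.trans_le (Fact.out : 1 ≤ p i)).ne'
  have := ENNReal.toReal_mono (by simpa using hp) (ENNReal.inv_le_inv.2 hi)
  simpa using this

end Main

/-! ### Optimality: diagonal forms -/

section Optimality

variable {𝕜 : Type*} [RCLike 𝕜] {n : ℕ}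

theorem mixedNorm_slice_le {m : ℕ} {s : Fin (m + 1) → ℝ≥0∞} (hs : ∀ k, s k ≠ 0)
    (f : (Fin (m + 1) → Fin n) → 𝕜) (j : Fin n) :
    mixedNorm (fun k => s k.succ) (fun J => f (Fin.cons j J)) ≤ mixedNorm s f := by
  have h0 : ∀ j, 0 ≤ mixedNorm (fun k => s k.succ) (fun J => f (Fin.cons j J)) := fun j =>
    mixedNorm_nonneg _ (fun k => hs k.succ) _
  rcases eq_or_ne (s 0) ∞ with h | h
  · conv_rhs => rw [mixedNorm]
    generalize s 0 = t at h
    subst h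
    rw [PiLp.norm_eq_ciSup]
    refine le_trans (le_abs_self _) (le_ciSup (f := fun j =>
      ‖mixedNorm (fun k => s k.succ) (fun J => f (Fin.cons j J))‖) (Set.finite_range _).bddAbove j)
  · have hpos := ENNReal.toReal_pos (hs 0) h
    rw [mixedNorm_succ hs h]
    refine le_trans (Real.rpow_rpow_inv (h0 j) hpos.ne').ge (Real.rpow_le_rpow
      (Real.rpow_nonneg (h0 j) _) ?_ (inv_nonneg.2 hpos.le))
    exact Finset.single_le_sum (f := fun j =>
      mixedNorm (fun k => s k.succ) (fun J => f (Fin.cons j J)) ^ (s 0).toReal)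
      (fun j _ => Real.rpow_nonneg (h0 j) _) (Finset.mem_univ j)

theorem norm_le_mixedNorm {m : ℕ} {s : Fin m → ℝ≥0∞} (hs : ∀ k, s k ≠ 0)
    (f : (Fin m → Fin n) → 𝕜) (J : Fin m → Fin n) : ‖f J‖ ≤ mixedNorm s f := by
  induction m with
  | zero => rw [mixedNorm, Subsingleton.elim J Fin.elim0]
  | succ m ih =>
    refine le_trans ?_ (mixedNorm_slice_le hs f (J 0))
    refine le_trans ?_ (ih (fun k => hs k.succ) _ (Fin.tail J))
    rw [Fin.cons_self_tail]

/-- The outer indices are restricted to the slice at `c`, which only decreases the norm; the n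
slices in index k then each have norm at least 1. -/
theorem rpow_inv_le_mixedNorm {m : ℕ} {s : Fin m → ℝ≥0∞} (hs : ∀ k, s k ≠ 0) {k : Fin m}
    (hk : s k ≠ ∞) {f : (Fin m → Fin n) → 𝕜} {c : Fin n}
    (h : ∀ j, ∃ J : Fin m → Fin n, J k = j ∧ (∀ l < k, J l = c) ∧ 1 ≤ ‖f J‖) :
    (n : ℝ) ^ (s k).toReal⁻¹ ≤ mixedNorm s f := by
  induction m with
  | zero => exact k.elim0
  | succ m ih =>
    cases k using Fin.cases with
    | zero =>
      have hpos := ENNReal.toReal_pos (hs 0) hk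
      rw [mixedNorm_succ hs hk]
      refine Real.rpow_le_rpow (Nat.cast_nonneg n) ?_ (inv_nonneg.2 hpos.le)
      calc (n : ℝ) = ∑ _j : Fin n, (1 : ℝ) := by simp
        _ ≤ _ := by
          refine Finset.sum_le_sum fun j _ => Real.one_le_rpow ?_ hpos.le
          obtain ⟨J, rfl, -, hJ⟩ := h j
          refine le_trans ?_ (norm_le_mixedNorm (fun k => hs k.succ) _ (Fin.tail J))
          rwa [Fin.cons_self_tail]
    | succ k =>
      refine le_trans ?_ (mixedNorm_slice_le hs f c)
      refine ih (fun k => hs k.succ) hk fun j => ?_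
      obtain ⟨J, hJk, hJ, hJ1⟩ := h j
      refine ⟨Fin.tail J, hJk, fun l hl => hJ l.succ (Fin.succ_lt_succ_iff.2 hl), ?_⟩
      rwa [← hJ 0 (Fin.succ_pos k), Fin.cons_self_tail]

/-- Hölder's inequality for products of weights with exponents of sum at most `1`. -/
theorem sum_prod_rpow_le {ι : Type*} (T : Finset ι) {r : ι → ℝ} (hr : ∀ l, 0 ≤ r l)
    (hr1 : ∑ l ∈ T, r l ≤ 1) (hn : 0 < n) {y : ι → Fin n → ℝ} (hy : ∀ l j, 0 ≤ y l j)
    (hy1 : ∀ l, ∑ j, y l j ≤ 1) :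
    ∑ j, ∏ l ∈ T, y l j ^ r l ≤ (n : ℝ) ^ (1 - ∑ l ∈ T, r l) := by
  set R := ∑ l ∈ T, r l with hR
  have hn' : (0 : ℝ) < n := Nat.cast_pos.2 hn
  have key : ∀ j, (∏ l ∈ T, y l j ^ r l) * ((n : ℝ)⁻¹) ^ (1 - R)
      ≤ (1 - R) * (n : ℝ)⁻¹ + ∑ l ∈ T, r l * y l j := by
    intro j
    -- Weighted AM-GM, with the missing mass 1 - R placed on the constant 1/n (the index `none`).
    -- Summed over j, the right side is at most 1.
    have := Real.geom_mean_le_arith_mean_weighted (Finset.insertNone T)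
      (fun o => o.elim (1 - R) r) (fun o => o.elim (n : ℝ)⁻¹ fun l => y l j)
      (by rintro (_ | l) _ <;> simp [hr, hr1]) (by simp [← hR])
      (by rintro (_ | l) _ <;> simp [hy])
    simpa [mul_comm] using this
  have h := Finset.sum_le_sum fun j (_ : j ∈ Finset.univ) => key j
  rw [← Finset.sum_mul, Finset.sum_add_distrib, Finset.sum_comm] at h
  simp only [← Finset.mul_sum] at h
  have h2 : ∑ l ∈ T, r l * ∑ j, y l j ≤ R :=
    Finset.sum_le_sum fun l _ => mul_le_of_le_one_right (hr l) (hy1 l)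
  have h3 : (1 - R) * ∑ _j : Fin n, (n : ℝ)⁻¹ = 1 - R := by
    simp [hn'.ne']
  rw [h3, Real.inv_rpow hn'.le, ← div_eq_mul_inv, div_le_iff₀ (by positivity)] at h
  have h4 : 0 < (n : ℝ) ^ (1 - R) := by positivity
  nlinarith

variable {m : ℕ} (p : Fin m → ℝ≥0∞)

/-- The form `∑ j, (∏ l < k, z l c) * (∏ l ≥ k, z l j)`. -/
noncomputable def diagonalForm (𝕜 : Type*) [RCLike 𝕜] (k : Fin m) (c : Fin n) :
    ContinuousMultilinearMap 𝕜 (fun k : Fin m => PiLp (p k) (fun _ : Fin n => 𝕜)) 𝕜 :=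
  ∑ j : Fin n, (ContinuousMultilinearMap.mkPiAlgebra 𝕜 (Fin m) 𝕜).compContinuousLinearMap
    fun l => PiLp.proj (p l) (fun _ : Fin n => 𝕜) (if l < k then c else j)

theorem diagonalForm_apply (k : Fin m) (c : Fin n)
    (z : ∀ k : Fin m, PiLp (p k) (fun _ : Fin n => 𝕜)) :
    diagonalForm p 𝕜 k c z = ∑ j, ∏ l, z l (if l < k then c else j) := by
  simp [diagonalForm]

theorem diagonalForm_single (k : Fin m) (c j : Fin n) :
    diagonalForm p 𝕜 k c
      (fun l => WithLp.toLp (p l) (Pi.single (if l < k then c else j) (1 : 𝕜))) = 1 := by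
  rw [diagonalForm_apply, Finset.sum_eq_single j]
  · simp
  · intro b _ hb
    exact Finset.prod_eq_zero (Finset.mem_univ k) (by simp [hb])
  · simp

variable [∀ k, Fact (1 ≤ p k)]

/-- The frozen coordinates contribute factors at most 1; Hölder over the variables from k on does
the rest. -/
theorem norm_diagonalForm_le (k : Fin m) (c : Fin n)
    (h : ∑ l ∈ Finset.Ici k, (p l)⁻¹.toReal ≤ 1) :
    ‖diagonalForm p 𝕜 k c‖ ≤ (n : ℝ) ^ (1 - ∑ l ∈ Finset.Ici k, (p l)⁻¹.toReal) := by
  refine ContinuousMultilinearMap.opNorm_le_bound (by positivity) fun z => ?_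
  choose y hy hy1 hyz using fun l => PiLp.exists_weight (z l)
  have hyle : ∀ l j, y l j ≤ 1 := fun l j =>
    (Finset.single_le_sum (fun j _ => hy l j) (Finset.mem_univ j)).trans (hy1 l)
  rw [diagonalForm_apply]
  calc ‖∑ j, ∏ l, z l (if l < k then c else j)‖
      ≤ ∑ j, ∏ l, ‖z l (if l < k then c else j)‖ :=
        (norm_sum_le _ _).trans_eq (Finset.sum_congr rfl fun j _ => norm_prod _ _)
    _ ≤ ∑ j, ∏ l, (‖z l‖ * y l (if l < k then c else j) ^ (p l)⁻¹.toReal) :=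
        Finset.sum_le_sum fun j _ => Finset.prod_le_prod (fun _ _ => norm_nonneg _)
          fun l _ => hyz l _
    _ = (∑ j, ∏ l, y l (if l < k then c else j) ^ (p l)⁻¹.toReal) * ∏ l, ‖z l‖ := by
        rw [Finset.sum_mul]
        exact Finset.sum_congr rfl fun j _ => by rw [Finset.prod_mul_distrib, mul_comm]
    _ ≤ (∑ j, ∏ l ∈ Finset.Ici k, y l j ^ (p l)⁻¹.toReal) * ∏ l, ‖z l‖ := by
        refine mul_le_mul_of_nonneg_right (Finset.sum_le_sum fun j _ => ?_)
          (Finset.prod_nonneg fun _ _ => norm_nonneg _)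
        rw [← Finset.prod_mul_prod_compl (Finset.Ici k)]
        have e : ∏ l ∈ Finset.Ici k, y l (if l < k then c else j) ^ (p l)⁻¹.toReal
            = ∏ l ∈ Finset.Ici k, y l j ^ (p l)⁻¹.toReal :=
          Finset.prod_congr rfl fun l hl => by rw [if_neg (not_lt.2 (Finset.mem_Ici.1 hl))]
        rw [e]
        exact mul_le_of_le_one_right
          (Finset.prod_nonneg fun l _ => Real.rpow_nonneg (hy l j) _)
          (Finset.prod_le_one (fun l _ => Real.rpow_nonneg (hy l _) _)
            fun l _ => Real.rpow_le_one (hy l _) (hyle l _) ENNReal.toReal_nonneg)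
    _ ≤ _ := mul_le_mul_of_nonneg_right (sum_prod_rpow_le _ (fun _ => ENNReal.toReal_nonneg) h
        c.pos hy hy1) (Finset.prod_nonneg fun _ _ => norm_nonneg _)

variable {p}

/-- Lower bound for the exponents in a Hardy-Littlewood inequality. -/
theorem HardyLittlewoodInequality.le_exponent (h : ∑ k, (p k)⁻¹ < 1) {t : Fin m → ℝ≥0∞}
    (ht : ∀ k, 0 < t k) {D : ℝ} (H : HardyLittlewoodInequality 𝕜 p t D) (k : Fin m) :
    ENNReal.ofReal (1 - ∑ l ∈ Finset.Ici k, (p l)⁻¹.toReal)⁻¹ ≤ t k := by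
  rcases eq_or_ne (t k) ∞ with htop | htop
  · rw [htop]; exact le_top
  have h1 := sum_toReal_inv_lt_one h
  have h2 := sum_Ici_le_sum (r := fun k => (p k)⁻¹.toReal) (fun _ => ENNReal.toReal_nonneg) k
  set R := ∑ l ∈ Finset.Ici k, (p l)⁻¹.toReal with hR
  have ht0 : ∀ k, t k ≠ 0 := fun k => (ht k).ne'
  have hpos := ENNReal.toReal_pos (ht0 k) htop
  refine ENNReal.ofReal_le_of_le_toReal ?_
  rw [inv_le_comm₀ (by linarith) hpos]
  by_contra! hlt
  -- The exponent is positive by `hlt`, so boundedness in n is absurd.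
  have key : ∀ n : ℕ, 0 < n → (n : ℝ) ^ ((t k).toReal⁻¹ - (1 - R)) ≤ |D| := by
    intro n hn
    have hn' : (0 : ℝ) < n := Nat.cast_pos.2 hn
    have hlow := rpow_inv_le_mixedNorm (𝕜 := 𝕜) ht0 htop (c := ⟨0, hn⟩)
      (f := fun J => diagonalForm p 𝕜 k ⟨0, hn⟩
        fun l => WithLp.toLp (p l) (Pi.single (J l) (1 : 𝕜)))
      fun j => ⟨fun l => if l < k then ⟨0, hn⟩ else j, by simp, fun l hl => if_pos hl, by
        rw [diagonalForm_single]; simp⟩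
    have hup := H n hn (diagonalForm p 𝕜 k ⟨0, hn⟩)
    have hnorm := norm_diagonalForm_le (𝕜 := 𝕜) p k ⟨0, hn⟩ (by linarith)
    rw [Real.rpow_sub hn', div_le_iff₀ (by positivity)]
    calc _ ≤ D * ‖diagonalForm p 𝕜 k ⟨0, hn⟩‖ := hlow.trans hup
      _ ≤ |D| * ‖diagonalForm p 𝕜 k ⟨0, hn⟩‖ := by gcongr; exact le_abs_self D
      _ ≤ _ := by gcongr
  have hlim := (tendsto_rpow_atTop (sub_pos.2 hlt)).comp tendsto_natCast_atTop_atTop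
  obtain ⟨n, hn, hn0⟩ := ((hlim.eventually_gt_atTop |D|).and
    (Filter.eventually_gt_atTop 0)).exists
  exact absurd (key n hn0) (not_le.2 hn)

end Optimality

theorem mainTheorem6 (m : ℕ) (hm : 2 ≤ m) :
    ∃ C : ℝ, ∀ (𝕜 : Type*) [RCLike 𝕜] (p : Fin m → ℝ≥0∞) [∀ k, Fact (1 ≤ p k)] (i : Fin m),
      1 / 2 ≤ ∑ k, (p k)⁻¹ → ∑ k, (p k)⁻¹ < 1 → 1 < p i → p i ≤ 2 →
        HardyLittlewoodInequality 𝕜 p (hlExponent p i) C ∧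
        ((i : ℕ) + 1 = m → HardyLittlewoodInequality 𝕜 p (hlExponent p i) 1) ∧
        ∀ t : Fin m → ℝ≥0∞, (∀ k, 0 < t k) →
          (∃ D : ℝ, HardyLittlewoodInequality 𝕜 p t D) →
            ∀ k : Fin m, k ≤ i → hlExponent p i k ≤ t k := by
  refine ⟨2 ^ m, fun 𝕜 _ p _ i _ h _ hi => ⟨?_, fun him => ?_, fun t ht ⟨D, H⟩ k hk => ?_⟩⟩
  · exact hardyLittlewoodInequality_of_le h hi (one_le_pow₀ one_le_two) (Or.inr le_rfl)
  · exact hardyLittlewoodInequality_of_le h hi le_rfl (Or.inl him)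
  · rw [hlExponent_eq h, realExponent, if_pos hk]
    exact H.le_exponent h ht k
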